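/- **Setting.** Let $\mathcal M=(S,A,T,p_0,r,\gamma,O,\Omega)$ be a POMDP with finite sets $S$, $A$, $O$ of states, actions and observations, transition probabilities $T(s,a,s')$, initial distribution $p_0$, reward $r:S\to\mathbb R$, discount factor $\gamma\in(0,1)$ and observation probabilities $\Omega(s,o)$. A belief is a probability distribution $b$ on $S$; after taking $a$ at $b$, the observation $o$ has probability $\sum_{s'}\Omega(s',o)\sum_s T(s,a,s')b(s)$, and $b$ is then updated to $b'(s')\propto\Omega(s',o)\sum_sT(s,a,s')b(s)$. Let $\varphi$ be an iLTL formula, i.e. a formula $\varphi::=f\mid\neg\varphi\mid\varphi\wedge\varphi\mid X\varphi\mid\varphi\,U_T\,\varphi$ with $T\in\mathbb N\cup\{\infty\}$ and atomic propositions $f:\mathbb R^S\to\mathbb R$, interpreted on belief sequences $\sigma$, where $\sigma\models f$ iff $f(\sigma(0))>0$, and $\sigma\models\varphi_1U_T\varphi_2$ iff there is $t\le T$ such that $\sigma^{[t]}\models\varphi_2$ and $\sigma^{[t']}\models\varphi_1$ for all $t'\le t$. Let $L(b)$ be the set of atomic propositions $f$ of $\varphi$ with $f(b)>0$. Let $\mathcal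 A$ be a limit-deterministic Büchi automaton with finite state set $Q$, transition function $\delta$, initial state $q_0$ and accepting states $B$, that realizes $\varphi$: a belief sequence satisfies $\varphi$ iff its sequence of labels $L(b_0)L(b_1)\cdots$ is accepted by $\mathcal A$. The states of the product belief MDP are the pairs $(b,q)$; under $a\in A$, the state $(b,q)$ moves to $(b',q')$, where $b'$ is the updated belief and $q'=\delta(q,L(b))$. **Algorithm 1** (learning on the product belief MDP). It keeps finite non-empty sets $\Theta_{q,a},\Theta'_{q,a}\subset\mathbb R^S$ ($q\in Q$, $a\in A$), initialized arbitrarily, which represent $$Q_r((b,q),a)=\max_{\theta\in\Theta_{q,a}}\sum_s\theta(s)b(s),\qquad Q_p((b,q),a)=\max_{\theta\in\Theta'_{q,a}}\sum_s\theta(s)b(s).$$ Put $\Theta_q=\bigcup_a\Theta_{q,a}$; put $\Theta'_q=\{\mathbf 1\}$ if $q\in B$ (that is, $V_p=1$ at accepting states) and $\Theta'_q=\bigcup_a\Theta'_{q,a}$ otherwise; $V_r((b,q))$ and $V_p((b,q))$ are the maxima of $\sum_s\theta(s)b(s)$ over $\Theta_q$ and $\Theta'_q$. It also keeps a record $\Xi$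 of all the sampled transitions, initially empty, and a current state, initially $(p_0,q_0)$. Each pass through the loop, with current state $(b,q)$, does the following. 1. With probability $1-\epsilon$ choose $a$ in $A_{\rm safe}((b,q))=\{a: Q_p((b,q),a)=1\}$ (any $a$ if this set is empty); with probability $\epsilon$ choose any $a\in A$. 2. Take $a$, observe $o$, compute $b'$ and $q'=\delta(q,L(b))$, and add $((b,q),a,(b',q'))$ to $\Xi$. 3. Let $b'_1,\dots,b'_n$ be all the updated beliefs recorded in $\Xi$ for the action $a$ at the belief $b$. Add to $\Theta_{q,a}$ the vector $r+\frac{\gamma}{n}\sum_{i}\operatorname{argmax}_{\theta\in\Theta_{q'}}\sum_s\theta(s)b'_i(s)$, and to $\Theta'_{q,a}$ the vector $\frac1n\sum_{i}\operatorname{argmax}_{\theta\in\Theta'_{q'}}\sum_s\theta(s)b'_i(s)$. Then prune both sets: vectors may be removed so long as the maximum $\max_\theta\sum_s\theta(s)b(s)$ is unchanged at every belief. 4. Randomly pick a new current state among those that have appeared in $\Xi$. The exploration probability $\epsilon\in[0,1]$, the initial sets, the tie-breaking in the argmax, the pruning rule and the distributions used for the random choices in steps 1 and 4 are arbitrary.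 **Theorem (Algorithm 1 converges).** For every such $\mathcal M$, $\varphi$ and $\mathcal A$, and every choice of these parameters, Algorithm 1 converges: along every possible execution (every sequence of passes each of which has positive probability), and hence with probability one, the learned Q-functions $Q_r$ and $Q_p$, together with the learned value functions $V_r$ and $V_p$, converge as the number of passes tends to infinity, uniformly in the belief $b$, the automaton state $q$ and the action $a$. -/

import Mathlib

open scoped NNReal ENNReal Topology
open MeasureTheory Filter

/-- The probability distributions on the finite set `S` (the beliefs). -/
abbrev Belief (S : Type*) [Fintype S] : Type _ := stdSimplex ℝ S

/-- A partially observable Markov decision process with finite state set `S`, action set `A` and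
observation set `O`; all actions are enabled in every state. -/
structure POMDP (S A O : Type*) [Fintype S] [Fintype O] where
  /-- `T s a s'` is the probability of moving from `s` to `s'` under the action `a`. -/
  T : S → A → S → ℝ
  T_nonneg : ∀ s a s', 0 ≤ T s a s'
  T_sum : ∀ s a, ∑ s', T s a s' = 1
  /-- the initial distribution -/
  p₀ : Belief S
  /-- the immediate reward -/
  r : S → ℝ
  /-- the discount factor -/
  γ : ℝ
  γ_pos : 0 < γ
  γ_lt_one : γ < 1
  /-- `Obs s o` is the probability of observing `o` in the state `s`. -/
  Obs : S → O → ℝ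
  Obs_nonneg : ∀ s o, 0 ≤ Obs s o
  Obs_sum : ∀ s, ∑ o, Obs s o = 1

namespace POMDP

variable {S A O : Type*} [Fintype S] [Fintype O] (M : POMDP S A O)

/-- The unnormalised posterior weight of `s'` after taking `a` at belief `b` and observing `o`. -/
def weight (b : Belief S) (a : A) (o : O) (s' : S) : ℝ :=
  M.Obs s' o * ∑ s, M.T s a s' * b.1 s

/-- The probability of observing `o` after taking the action `a` at the belief `b`. -/
def obsProb (b : Belief S) (a : A) (o : O) : ℝ := ∑ s', M.weight b a o s'

theorem weight_nonneg (b : Belief S) (a : A) (o : O) (s' : S) : 0 ≤ M.weight b a o s' :=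
  mul_nonneg (M.Obs_nonneg s' o)
    (Finset.sum_nonneg fun s _ => mul_nonneg (M.T_nonneg s a s') (b.2.1 s))

theorem obsProb_nonneg (b : Belief S) (a : A) (o : O) : 0 ≤ M.obsProb b a o :=
  Finset.sum_nonneg fun s' _ => M.weight_nonneg b a o s'

theorem obsProb_sum (b : Belief S) (a : A) : ∑ o, M.obsProb b a o = 1 := by
  unfold obsProb weight
  rw [Finset.sum_comm]
  simp_rw [← Finset.sum_mul, M.Obs_sum, one_mul]
  rw [Finset.sum_comm]
  simp_rw [← Finset.sum_mul, M.T_sum, one_mul]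
  exact b.2.2

/-- The law of the observation made after taking the action `a` at the belief `b`. -/
noncomputable def obsLaw (b : Belief S) (a : A) : PMF O :=
  PMF.ofFintype (fun o => ENNReal.ofReal (M.obsProb b a o)) (by
    rw [← ENNReal.ofReal_sum_of_nonneg fun o _ => M.obsProb_nonneg b a o, M.obsProb_sum,
      ENNReal.ofReal_one])

open Classical in
/-- The Bayes update of the belief `b` on taking `a` and observing `o`. Bayes' rule says nothing
about an observation of probability zero; such an observation never occurs, and the value `b` is
then a dummy. -/
noncomputable def update (b : Belief S) (a : A) (o : O) : Belief S :=
  if h : M.obsProb b a o = 0 then b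
  else ⟨fun s' => M.weight b a o s' / M.obsProb b a o,
    fun s' => div_nonneg (M.weight_nonneg b a o s') (M.obsProb_nonneg b a o), by
      rw [← Finset.sum_div]; exact div_self h⟩

open Classical in
/-- The transition probabilities `T_D (b, a, b')` of the belief MDP. -/
noncomputable def beliefTrans (b : Belief S) (a : A) (b' : Belief S) : ℝ :=
  ∑ o, ∑ s', ∑ s, (if M.update b a o = b' then 1 else 0) * M.Obs s' o * M.T s a s' * b.1 s

end POMDP

/-- iLTL formulas over `S`. An atomic proposition is a function `ℝ^S → ℝ`; the bound of the until
operator is a natural number, or `⊤` for the unbounded until. -/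
inductive ILTL (S : Type*) where
  | atom (f : (S → ℝ) → ℝ) : ILTL S
  | neg (φ : ILTL S) : ILTL S
  | and (φ ψ : ILTL S) : ILTL S
  | next (φ : ILTL S) : ILTL S
  | untl (T : ℕ∞) (φ ψ : ILTL S) : ILTL S

namespace ILTL

variable {S : Type*}

/-- The set of atomic propositions that occur in a formula. -/
def atoms : ILTL S → Set ((S → ℝ) → ℝ)
  | atom f => {f}
  | neg φ => φ.atoms
  | and φ ψ => φ.atoms ∪ ψ.atoms
  | next φ => φ.atoms
  | untl _ φ ψ => φ.atoms ∪ ψ.atoms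

theorem atoms_finite (φ : ILTL S) : φ.atoms.Finite := by
  induction φ with
  | atom f => exact Set.finite_singleton f
  | neg φ ih => exact ih
  | and φ ψ ih₁ ih₂ => exact ih₁.union ih₂
  | next φ ih => exact ih
  | untl T φ ψ ih₁ ih₂ => exact ih₁.union ih₂

/-- Satisfaction of a formula by an execution, that is, by a sequence of state distributions. -/
def Sat [Fintype S] : (ℕ → Belief S) → ILTL S → Prop
  | σ, atom f => 0 < f (σ 0).1
  | σ, neg φ => ¬ Sat σ φ
  | σ, and φ ψ => Sat σ φ ∧ Sat σ ψ
  | σ, next φ => Sat (fun i => σ (1 + i)) φ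
  | σ, untl T φ ψ => ∃ t : ℕ, (t : ℕ∞) ≤ T ∧ Sat (fun i => σ (t + i)) ψ ∧
      ∀ t' ≤ t, Sat (fun i => σ (t' + i)) φ

/-- The label `L(b)`: the atomic propositions of `φ` that hold at the belief `b`. -/
def label [Fintype S] (φ : ILTL S) (b : Belief S) : Set φ.atoms := {f | 0 < f.1 b.1}

end ILTL

/-- A limit-deterministic Büchi automaton with state set `Q` and alphabet `Λ`. The transitions on
letters are total and deterministic; `eps q` is the set of states reachable from `q` by one
`ε`-move. -/
structure LDBA (Q Λ : Type*) where
  δ : Q → Λ → Q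
  eps : Q → Set Q
  /-- the initial state -/
  q₀ : Q
  /-- the accepting states -/
  B : Set Q
  /-- the accepting component; its complement is the initial component -/
  QA : Set Q
  δ_mem : ∀ q ∈ QA, ∀ l, δ q l ∈ QA
  eps_empty : ∀ q ∈ QA, eps q = ∅
  B_subset : B ⊆ QA

namespace LDBA

variable {Q Λ : Type*} (𝒜 : LDBA Q Λ)

/-- A word is accepted if it has a path, which may use `ε`-moves and reads the whole word, that
visits some accepting state infinitely often. Here `q k` is the state after `k` moves and `pos k`
the number of letters read so far. -/
def Accepts (w : ℕ → Λ) : Prop :=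
  ∃ (q : ℕ → Q) (pos : ℕ → ℕ), q 0 = 𝒜.q₀ ∧ pos 0 = 0 ∧
    (∀ k, (q (k + 1) = 𝒜.δ (q k) (w (pos k)) ∧ pos (k + 1) = pos k + 1) ∨
      (q (k + 1) ∈ 𝒜.eps (q k) ∧ pos (k + 1) = pos k)) ∧
    Tendsto pos atTop atTop ∧
    ∃ p ∈ 𝒜.B, ∃ᶠ k in atTop, q k = p

/-- The automaton realizes `φ`: it accepts (the word of labels of) an execution exactly when the
execution satisfies `φ`. -/
def Realizes {S : Type*} [Fintype S] {φ : ILTL S} (𝒜 : LDBA Q (Set φ.atoms)) : Prop :=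
  ∀ σ : ℕ → Belief S, ILTL.Sat σ φ ↔ 𝒜.Accepts (fun t => φ.label (σ t))

end LDBA

/-! The product belief MDP: its states are pairs `(b, q)`, its actions `A ∪ {ε}` are written as
`Option A`, with `none` for `ε`. -/

section Product

variable {S A O Q : Type*} [Fintype S] [Fintype O] (M : POMDP S A O) {φ : ILTL S}
  (𝒜 : LDBA Q (Set φ.atoms))

open Classical in
/-- The transition probabilities of the product belief MDP. -/
noncomputable def prodTrans (p : Belief S × Q) (a : Option A) (p' : Belief S × Q) : ℝ :=
  match a with
  | some a => if p'.2 = 𝒜.δ p.2 (φ.label p.1) then M.beliefTrans p.1 a p'.1 else 0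
  | none => if p'.2 ∈ 𝒜.eps p.2 ∧ p.1 = p'.1 then 1 else 0

/-- The law of the successor of the product state `p` under the action `a ∈ A`: an observation `o`
is made, the belief is updated by Bayes' rule and the automaton moves to `δ (q, L(b))`. -/
noncomputable def prodStep (p : Belief S × Q) (a : A) : PMF (Belief S × Q) :=
  (M.obsLaw p.1 a).map fun o => (M.update p.1 a o, 𝒜.δ p.2 (φ.label p.1))

theorem prodStep_apply (p : Belief S × Q) (a : A) (p' : Belief S × Q) :
    prodStep M 𝒜 p a p' = ENNReal.ofReal (prodTrans M 𝒜 p (some a) p') := by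
  classical
  have key : M.beliefTrans p.1 a p'.1 =
      ∑ o, if M.update p.1 a o = p'.1 then M.obsProb p.1 a o else 0 := by
    unfold POMDP.beliefTrans POMDP.obsProb POMDP.weight
    refine Finset.sum_congr rfl fun o _ => ?_
    split_ifs with h
    · simp [Finset.mul_sum, mul_assoc]
    · simp
  have hp : ∀ o, (p' = (M.update p.1 a o, 𝒜.δ p.2 (φ.label p.1))) ↔
      (p'.2 = 𝒜.δ p.2 (φ.label p.1) ∧ M.update p.1 a o = p'.1) := by
    intro o
    rw [Prod.ext_iff]
    constructor
    · rintro ⟨h₁, h₂⟩; exact ⟨h₂, h₁.symm⟩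
    · rintro ⟨h₁, h₂⟩; exact ⟨h₂.symm, h₁⟩
  rw [prodStep, PMF.map_apply, tsum_fintype]
  simp only [hp, prodTrans]
  by_cases h : p'.2 = 𝒜.δ p.2 (φ.label p.1)
  · simp only [h, true_and, if_true]
    rw [key, ENNReal.ofReal_sum_of_nonneg]
    · refine Finset.sum_congr rfl fun o _ => ?_
      split_ifs
      · rfl
      · simp
    · intro o _
      split_ifs
      · exact M.obsProb_nonneg _ _ _
      · exact le_rfl
  · simp [h]

end Product

/-! The learning algorithm. -/

/-- The linear function on beliefs given by the vector `θ`. -/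
def linVal {S : Type*} [Fintype S] (θ : S → ℝ) (b : Belief S) : ℝ := ∑ s, θ s * b.1 s

/-- The piecewise linear function `b ↦ max_{θ ∈ Θ} ∑ s, θ s * b s` of a finite set of vectors. -/
noncomputable def maxVal {S : Type*} [Fintype S] (Θ : Finset (S → ℝ)) (b : Belief S) : ℝ :=
  ⨆ θ : {θ // θ ∈ Θ}, linVal θ.1 b

/-- The memory of the learning algorithm. -/
structure Config (S A Q : Type*) [Fintype S] where
  /-- the sets `Θ_{q,a}` that represent `Q_r` -/
  Θr : Q → A → Finset (S → ℝ)
  /-- the sets `Θ'_{q,a}` that represent `Q_p` -/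
  Θp : Q → A → Finset (S → ℝ)
  /-- the list `Ξ` of all the sampled transitions `((b, q), a, (b', q'))` -/
  Ξ : List ((Belief S × Q) × A × (Belief S × Q))
  /-- the current product state -/
  cur : Belief S × Q

namespace Config

variable {S A Q : Type*} [Fintype S] (c : Config S A Q)

/-- The learned `Q_r`. -/
noncomputable def Qr (p : Belief S × Q) (a : A) : ℝ := maxVal (c.Θr p.2 a) p.1

/-- The learned `Q_p`. -/
noncomputable def Qp (p : Belief S × Q) (a : A) : ℝ := maxVal (c.Θp p.2 a) p.1

/-- The actions that are safe according to the learned `Q_p`. -/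
def safe (p : Belief S × Q) : Set A := {a | c.Qp p a = 1}

/-- The product states that have appeared in `Ξ`. -/
def visited : Set (Belief S × Q) := {p | ∃ e ∈ c.Ξ, p = e.1 ∨ p = e.2.2}

open Classical in
/-- The set `Θ_q = ⋃_a Θ_{q,a}` that represents `V_r`. -/
noncomputable def ΘVr [Fintype A] (q : Q) : Finset (S → ℝ) :=
  Finset.univ.biUnion fun a => c.Θr q a

open Classical in
/-- The set `Θ'_q` that represents `V_p`: the union `⋃_a Θ'_{q,a}`, except that `V_p = 1` is
imposed in the accepting states (the vector `1` gives the constant function `1` on beliefs). -/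
noncomputable def ΘVp [Fintype A] {Λ : Type*} (𝒜 : LDBA Q Λ) (q : Q) : Finset (S → ℝ) :=
  if q ∈ 𝒜.B then {1} else Finset.univ.biUnion fun a => c.Θp q a

/-- The learned `V_r`. -/
noncomputable def Vr [Fintype A] (p : Belief S × Q) : ℝ := maxVal (c.ΘVr p.2) p.1

/-- The learned `V_p`. -/
noncomputable def Vp [Fintype A] {Λ : Type*} (𝒜 : LDBA Q Λ) (p : Belief S × Q) : ℝ :=
  maxVal (c.ΘVp 𝒜 p.2) p.1

open Classical in
/-- The updated beliefs `b'_1, …, b'_n` recorded so far for the action `a` at the belief `b`; their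
empirical distribution is the estimate of `T_D (b, a, ·)`. -/
noncomputable def samples (b : Belief S) (a : A) : List (Belief S) :=
  (c.Ξ.filter fun e => e.1.1 = b ∧ e.2.1 = a).map fun e => e.2.2.1

end Config

/-- Everything that the algorithm leaves to the implementation, with the requirements that the
algorithm makes. -/
structure LearningRules (S A Q : Type*) [Fintype S] where
  /-- the exploration probability -/
  ε : ℝ≥0
  ε_le_one : ε ≤ 1
  /-- the initial sets of vectors for `Q_r` and for `Q_p` -/
  initΘr : Q → A → Finset (S → ℝ)
  initΘp : Q → A → Finset (S → ℝ)
  initΘr_nonempty : ∀ q a, (initΘr q a).Nonempty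
  initΘp_nonempty : ∀ q a, (initΘp q a).Nonempty
  /-- an element of `Θ` that maximizes `θ ↦ ∑ s, θ s * b s` (ties are broken in any way) -/
  argmax : Finset (S → ℝ) → Belief S → S → ℝ
  argmax_mem : ∀ Θ : Finset (S → ℝ), Θ.Nonempty → ∀ b, argmax Θ b ∈ Θ
  argmax_max : ∀ (Θ : Finset (S → ℝ)) (b), ∀ θ ∈ Θ, linVal θ b ≤ linVal (argmax Θ b) b
  /-- pruning: it removes vectors that are not needed in the maximum, at any belief -/
  prune : Finset (S → ℝ) → Finset (S → ℝ)
  prune_subset : ∀ Θ, prune Θ ⊆ Θ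
  prune_spec : ∀ (Θ : Finset (S → ℝ)) (b), ∀ θ ∈ Θ, ∃ θ' ∈ prune Θ, linVal θ b ≤ linVal θ' b
  /-- the law of the action taken with probability `1 - ε`; it is safe if a safe action exists -/
  exploit : Config S A Q → PMF A
  exploit_safe : ∀ c : Config S A Q, (c.safe c.cur).Nonempty → (exploit c).support ⊆ c.safe c.cur
  /-- the law of the action taken with probability `ε` -/
  explore : Config S A Q → PMF A
  /-- the law of the next current product state, which has appeared in `Ξ` -/
  pick : Config S A Q → PMF (Belief S × Q)
  pick_visited : ∀ c : Config S A Q, c.visited.Nonempty → (pick c).support ⊆ c.visited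

namespace LearningRules

variable {S A O Q : Type*} [Fintype S] [Fintype A] [Fintype O] (R : LearningRules S A Q)
  (M : POMDP S A O) {φ : ILTL S} (𝒜 : LDBA Q (Set φ.atoms))

/-- The vector `ρ + (g / n) ∑ i, argmax_{θ ∈ Θ} ∑ s, θ s * b'_i s` for the list `b'_1, …, b'_n`. -/
noncomputable def backup (ρ : S → ℝ) (g : ℝ) (Θ : Finset (S → ℝ)) (l : List (Belief S)) : S → ℝ :=
  ρ + (g / l.length) • (l.map (R.argmax Θ)).sum

/-- The start of the algorithm. -/
def init : Config S A Q where
  Θr := R.initΘr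
  Θp := R.initΘp
  Ξ := []
  cur := (M.p₀, 𝒜.q₀)

/-- The action is drawn from `exploit` with probability `1 - ε` and from `explore` with probability
`ε`. -/
noncomputable def chooseAction (c : Config S A Q) : PMF A :=
  (PMF.ofFintype (fun e : Bool => if e then (R.ε : ℝ≥0∞) else 1 - R.ε) (by
    simpa using add_tsub_cancel_of_le (ENNReal.coe_le_one_iff.2 R.ε_le_one))).bind
    fun e => if e then R.explore c else R.exploit c

open Classical in
/-- The memory after the transition from the current state `(b, q)` to `p' = (b', q')` under `a`
has been recorded and `Θ_{q,a}` and `Θ'_{q,a}` have been updated and pruned. The update of `Q_r`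
has reward `r` and discount `γ`, that of `Q_p` has reward `0` and no discount. -/
noncomputable def learn (c : Config S A Q) (a : A) (p' : Belief S × Q) : Config S A Q :=
  let b := c.cur.1
  let q := c.cur.2
  let q' := 𝒜.δ q (φ.label b)
  let Ξ := (c.cur, a, p') :: c.Ξ
  let l := Config.samples { c with Ξ := Ξ } b a
  { Θr := Function.update c.Θr q (Function.update (c.Θr q) a
      (R.prune (c.Θr q a ∪ {R.backup M.r M.γ (c.ΘVr q') l})))
    Θp := Function.update c.Θp q (Function.update (c.Θp q) a
      (R.prune (c.Θp q a ∪ {R.backup 0 1 (c.ΘVp 𝒜 q') l})))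
    Ξ := Ξ
    cur := c.cur }

/-- One pass through the loop of the algorithm: choose an action, take it, learn from the result,
and pick a new current state. -/
noncomputable def step (c : Config S A Q) : PMF (Config S A Q) :=
  (R.chooseAction c).bind fun a =>
    (prodStep M 𝒜 c.cur a).bind fun p' =>
      (R.pick (R.learn M 𝒜 c a p')).map fun p => { R.learn M 𝒜 c a p' with cur := p }

/-- A possible execution of the algorithm: it begins at the start, and every pass through the loop
has a result of positive probability. -/
def IsExecution (x : ℕ → Config S A Q) : Prop :=
  x 0 = R.init M 𝒜 ∧ ∀ n, x (n + 1) ∈ (R.step M 𝒜 (x n)).support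

/-- The random process `X` is a run of the algorithm: `X n` is the memory after `n` passes through
the loop. This is the Markov chain with initial state `init` and transition law `step`. -/
structure IsRun {W : Type*} [MeasurableSpace W] (P : Measure W) (X : ℕ → W → Config S A Q) :
    Prop where
  measurable : ∀ n c, MeasurableSet {ω | X n ω = c}
  start : ∀ᵐ ω ∂P, X 0 ω = R.init M 𝒜
  markov : ∀ (n : ℕ) (h : ℕ → Config S A Q),
    P {ω | ∀ i ≤ n + 1, X i ω = h i} =
      P {ω | ∀ i ≤ n, X i ω = h i} * R.step M 𝒜 (h n) (h (n + 1))

end LearningRules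

/-- The learned Q-functions `Q_r` and `Q_p`, and the learned value functions `V_r` and `V_p`,
converge, uniformly in the product state and the action. -/
def LearningConverges {S A Q Λ : Type*} [Fintype S] [Fintype A] (𝒜 : LDBA Q Λ)
    (x : ℕ → Config S A Q) : Prop :=
  (∃ F : (Belief S × Q) × A → ℝ, TendstoUniformly (fun n z => (x n).Qr z.1 z.2) F atTop) ∧
  (∃ F : (Belief S × Q) × A → ℝ, TendstoUniformly (fun n z => (x n).Qp z.1 z.2) F atTop) ∧
  (∃ F : Belief S × Q → ℝ, TendstoUniformly (fun n p => (x n).Vr p) F atTop) ∧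
  (∃ F : Belief S × Q → ℝ, TendstoUniformly (fun n p => (x n).Vp 𝒜 p) F atTop)

/-! Convergence comes from monotonicity, boundedness and compactness; no fixed-point argument and no
property of the samples enters.

A pass only adds vectors and prunes without lowering a maximum, so every represented function
increases pointwise (`dominated_learn_Θr`, `dominated_learn_Θp`). A backup is `ρ` plus `g` times an
average of vectors already present, so a sup-norm bound `C` with `1 ≤ C` and `‖r‖ + γ C ≤ C`
survives each pass (`learn_boundedBy`); for `Q_p` the averaging alone suffices. Vectors of norm at
most `C` give equi-Lipschitz functions on the compact simplex, so the monotone pointwise limits are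
uniform (`exists_tendstoUniformly_maxVal`), and `Q × A` is finite.

This covers every execution. For probability one, `IsRun.ae_isExecution` shows that a run is almost
surely an execution. The space of configurations is uncountable, but each transition law has
countable support, so only countably many null events have to be discarded at each time. -/

/-! ### Maxima of linear functions on the simplex of beliefs -/

section MaxVal

variable {S : Type*} [Fintype S]

theorem abs_linVal_le (θ : S → ℝ) (b : Belief S) : |linVal θ b| ≤ ‖θ‖ := by
  calc |linVal θ b| ≤ ∑ s, |θ s * b.1 s| := Finset.abs_sum_le_sum_abs _ _
    _ ≤ ∑ s, ‖θ‖ * b.1 s := by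
      refine Finset.sum_le_sum fun s _ => ?_
      rw [abs_mul, abs_of_nonneg (b.2.1 s)]
      exact mul_le_mul_of_nonneg_right (norm_le_pi_norm θ s) (b.2.1 s)
    _ = ‖θ‖ := by rw [← Finset.mul_sum, b.2.2, mul_one]

/-- Each coordinate contributes at most `‖θ‖` times the sup distance. The resulting Lipschitz
constant depends on `θ` only through its norm, which is what equicontinuity needs. -/
theorem linVal_le_add (θ : S → ℝ) (b b' : Belief S) :
    linVal θ b ≤ linVal θ b' + ‖θ‖ * (Fintype.card S * dist b b') := by
  have h : linVal θ b - linVal θ b' ≤ ∑ _s : S, ‖θ‖ * dist b b' := by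
    unfold linVal
    rw [← Finset.sum_sub_distrib]
    refine Finset.sum_le_sum fun s _ => ?_
    rw [← mul_sub]
    refine (le_abs_self _).trans ?_
    rw [abs_mul]
    exact mul_le_mul (norm_le_pi_norm θ s) (dist_le_pi_dist b.1 b'.1 s) (abs_nonneg _)
      (norm_nonneg _)
  rw [Finset.sum_const, Finset.card_univ, nsmul_eq_mul] at h
  linarith

theorem linVal_le_maxVal {Θ : Finset (S → ℝ)} {θ : S → ℝ} (h : θ ∈ Θ) (b : Belief S) :
    linVal θ b ≤ maxVal Θ b :=
  le_ciSup (f := fun θ : {θ // θ ∈ Θ} => linVal θ.1 b) (Set.finite_range _).bddAbove ⟨θ, h⟩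

theorem maxVal_le {Θ : Finset (S → ℝ)} (hΘ : Θ.Nonempty) {b : Belief S} {c : ℝ}
    (h : ∀ θ ∈ Θ, linVal θ b ≤ c) : maxVal Θ b ≤ c := by
  have : Nonempty {θ // θ ∈ Θ} := hΘ.to_subtype
  exact ciSup_le fun θ => h θ.1 θ.2

/-- `Θ'` dominates `Θ`: no vector of `Θ` exceeds all vectors of `Θ'` at any belief. -/
def Dominated (Θ Θ' : Finset (S → ℝ)) : Prop :=
  ∀ b, ∀ θ ∈ Θ, ∃ θ' ∈ Θ', linVal θ b ≤ linVal θ' b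

theorem Dominated.refl (Θ : Finset (S → ℝ)) : Dominated Θ Θ := fun _ θ h => ⟨θ, h, le_rfl⟩

theorem Dominated.maxVal_le {Θ Θ' : Finset (S → ℝ)} (h : Dominated Θ Θ') (hΘ : Θ.Nonempty)
    (b : Belief S) : maxVal Θ b ≤ maxVal Θ' b :=
  _root_.maxVal_le hΘ fun θ hθ => by
    obtain ⟨θ', h', hle⟩ := h b θ hθ
    exact hle.trans (linVal_le_maxVal h' b)

theorem maxVal_le_add {Θ : Finset (S → ℝ)} (hΘ : Θ.Nonempty) {C : ℝ} (hC : ∀ θ ∈ Θ, ‖θ‖ ≤ C)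
    (b b' : Belief S) : maxVal Θ b ≤ maxVal Θ b' + C * (Fintype.card S * dist b b') :=
  maxVal_le hΘ fun θ hθ => (linVal_le_add θ b b').trans <|
    add_le_add (linVal_le_maxVal hθ b') (mul_le_mul_of_nonneg_right (hC θ hθ) (by positivity))

/-- An increasing sequence of maxima of linear functions with bounded coefficients converges
uniformly on the beliefs. -/
theorem exists_tendstoUniformly_maxVal {Θ : ℕ → Finset (S → ℝ)} (hne : ∀ n, (Θ n).Nonempty)
    {C : ℝ} (hC : ∀ n, ∀ θ ∈ Θ n, ‖θ‖ ≤ C) (hmono : ∀ n, Dominated (Θ n) (Θ (n + 1))) :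
    ∃ F : Belief S → ℝ, TendstoUniformly (fun n => maxVal (Θ n)) F atTop := by
  -- Pointwise, a bounded increasing real sequence tends to its supremum.
  have hlim : ∀ b, Tendsto (fun n => maxVal (Θ n) b) atTop (𝓝 (⨆ n, maxVal (Θ n) b)) := fun b =>
    tendsto_atTop_ciSup (monotone_nat_of_le_succ fun n => (hmono n).maxVal_le (hne n) b) <| by
      refine ⟨C, ?_⟩
      rintro _ ⟨n, rfl⟩
      exact maxVal_le (hne n) fun θ hθ =>
        (le_abs_self _).trans ((abs_linVal_le θ b).trans (hC n θ hθ))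
  have hC0 : 0 ≤ C := by
    obtain ⟨θ, hθ⟩ := hne 0
    exact (norm_nonneg θ).trans (hC 0 θ hθ)
  have hequi : Equicontinuous (fun n => maxVal (Θ n)) := by
    refine (LipschitzWith.uniformEquicontinuous _ (Real.toNNReal (C * Fintype.card S))
      fun n => LipschitzWith.of_le_add_mul _ fun b b' => ?_).equicontinuous
    rw [Real.coe_toNNReal _ (by positivity), mul_assoc]
    exact maxVal_le_add (hne n) (hC n) b b'
  have : CompactSpace (Belief S) := isCompact_iff_compactSpace.1 (isCompact_stdSimplex ℝ S)
  -- On a compact space, pointwise and uniform convergence agree for an equicontinuous family.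
  exact ⟨_, UniformFun.tendsto_iff_tendstoUniformly.1
    ((hequi.tendsto_uniformFun_iff_pi _ _).2 (tendsto_pi_nhds.2 hlim))⟩

/-- Finitely many "eventually" statements hold simultaneously; this yields uniformity in the
automaton state and the action. -/
theorem exists_tendstoUniformly_maxVal_family {ι : Type*} [Finite ι]
    {Θ : ℕ → ι → Finset (S → ℝ)} (hne : ∀ n i, (Θ n i).Nonempty)
    {C : ℝ} (hC : ∀ n i, ∀ θ ∈ Θ n i, ‖θ‖ ≤ C)
    (hmono : ∀ n i, Dominated (Θ n i) (Θ (n + 1) i)) :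
    ∃ F : Belief S × ι → ℝ, TendstoUniformly (fun n z => maxVal (Θ n z.2) z.1) F atTop := by
  choose F hF using fun i => exists_tendstoUniformly_maxVal (Θ := fun n => Θ n i)
    (fun n => hne n i) (fun n => hC n i) (fun n => hmono n i)
  refine ⟨fun z => F z.2 z.1, Metric.tendstoUniformly_iff.2 fun ε hε => ?_⟩
  filter_upwards [eventually_all.2 fun i => Metric.tendstoUniformly_iff.1 (hF i) ε hε] with n hn
  exact fun z => hn z.2 z.1

end MaxVal

/-! ### Bounds and domination pass from Q-functions to value functions -/

namespace Config

variable {S A Q : Type*} [Fintype S]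

/-- The vector sets are non-empty, and their vectors have norm at most `C`. -/
structure BoundedBy (c : Config S A Q) (C : ℝ) : Prop where
  r_nonempty : ∀ q a, (c.Θr q a).Nonempty
  p_nonempty : ∀ q a, (c.Θp q a).Nonempty
  r_le : ∀ q a, ∀ θ ∈ c.Θr q a, ‖θ‖ ≤ C
  p_le : ∀ q a, ∀ θ ∈ c.Θp q a, ‖θ‖ ≤ C

namespace BoundedBy

variable {c : Config S A Q} {C : ℝ} [Fintype A]

theorem ΘVr_nonempty [Nonempty A] (h : c.BoundedBy C) (q : Q) : (c.ΘVr q).Nonempty :=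
  Finset.univ_nonempty.biUnion fun a _ => h.r_nonempty q a

theorem ΘVp_nonempty [Nonempty A] {Λ : Type*} (𝒜 : LDBA Q Λ) (h : c.BoundedBy C) (q : Q) :
    (c.ΘVp 𝒜 q).Nonempty := by
  unfold ΘVp
  split_ifs
  · exact Finset.singleton_nonempty _
  · exact Finset.univ_nonempty.biUnion fun a _ => h.p_nonempty q a

theorem ΘVr_le (h : c.BoundedBy C) (q : Q) : ∀ θ ∈ c.ΘVr q, ‖θ‖ ≤ C := by
  intro θ hθ
  obtain ⟨a, -, ha⟩ := Finset.mem_biUnion.1 hθ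
  exact h.r_le q a θ ha

/-- The condition `1 ≤ C` accounts for the vector `1` imposed at accepting states. -/
theorem ΘVp_le {Λ : Type*} (𝒜 : LDBA Q Λ) (h : c.BoundedBy C) (hC : 1 ≤ C) (q : Q) :
    ∀ θ ∈ c.ΘVp 𝒜 q, ‖θ‖ ≤ C := by
  intro θ hθ
  unfold ΘVp at hθ
  split_ifs at hθ
  · rw [Finset.mem_singleton.1 hθ]
    exact (pi_norm_le_iff_of_nonneg (zero_le_one.trans hC)).2 fun s => by simpa using hC
  · obtain ⟨a, -, ha⟩ := Finset.mem_biUnion.1 hθ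
    exact h.p_le q a θ ha

end BoundedBy

theorem dominated_ΘVr [Fintype A] {c c' : Config S A Q}
    (h : ∀ q a, Dominated (c.Θr q a) (c'.Θr q a)) (q : Q) : Dominated (c.ΘVr q) (c'.ΘVr q) := by
  intro b θ hθ
  obtain ⟨a, ha, hθ⟩ := Finset.mem_biUnion.1 hθ
  obtain ⟨θ', h', hle⟩ := h q a b θ hθ
  exact ⟨θ', Finset.mem_biUnion.2 ⟨a, ha, h'⟩, hle⟩

/-- Whether `q` is accepting does not depend on the configuration, so the imposed value never breaks
monotonicity. -/
theorem dominated_ΘVp [Fintype A] {Λ : Type*} (𝒜 : LDBA Q Λ) {c c' : Config S A Q}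
    (h : ∀ q a, Dominated (c.Θp q a) (c'.Θp q a)) (q : Q) :
    Dominated (c.ΘVp 𝒜 q) (c'.ΘVp 𝒜 q) := by
  unfold ΘVp
  split_ifs
  · exact Dominated.refl _
  · intro b θ hθ
    obtain ⟨a, ha, hθ⟩ := Finset.mem_biUnion.1 hθ
    obtain ⟨θ', h', hle⟩ := h q a b θ hθ
    exact ⟨θ', Finset.mem_biUnion.2 ⟨a, ha, h'⟩, hle⟩

end Config

/-- If the vector sets are non-empty, bounded and increasing along `x`, then the learned functions
converge. -/
theorem LearningConverges.of_dominated {S A Q Λ : Type*} [Fintype S] [Fintype A] [Nonempty A]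
    [Finite Q] (𝒜 : LDBA Q Λ) {x : ℕ → Config S A Q} {C : ℝ} (hC : 1 ≤ C)
    (hx : ∀ n, (x n).BoundedBy C)
    (hr : ∀ n q a, Dominated ((x n).Θr q a) ((x (n + 1)).Θr q a))
    (hp : ∀ n q a, Dominated ((x n).Θp q a) ((x (n + 1)).Θp q a)) :
    LearningConverges 𝒜 x := by
  refine ⟨?_, ?_, ?_, ?_⟩
  · obtain ⟨F, hF⟩ := exists_tendstoUniformly_maxVal_family (ι := Q × A)
      (Θ := fun n i => (x n).Θr i.1 i.2) (fun n i => (hx n).r_nonempty _ _)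
      (fun n i => (hx n).r_le _ _) (fun n i => hr n _ _)
    exact ⟨_, hF.comp fun z : (Belief S × Q) × A => (z.1.1, (z.1.2, z.2))⟩
  · obtain ⟨F, hF⟩ := exists_tendstoUniformly_maxVal_family (ι := Q × A)
      (Θ := fun n i => (x n).Θp i.1 i.2) (fun n i => (hx n).p_nonempty _ _)
      (fun n i => (hx n).p_le _ _) (fun n i => hp n _ _)
    exact ⟨_, hF.comp fun z : (Belief S × Q) × A => (z.1.1, (z.1.2, z.2))⟩
  · exact exists_tendstoUniformly_maxVal_family (Θ := fun n q => (x n).ΘVr q)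
      (fun n q => (hx n).ΘVr_nonempty q) (fun n q => (hx n).ΘVr_le q)
      (fun n q => Config.dominated_ΘVr (hr n) q)
  · exact exists_tendstoUniformly_maxVal_family (Θ := fun n q => (x n).ΘVp 𝒜 q)
      (fun n q => (hx n).ΘVp_nonempty 𝒜 q) (fun n q => (hx n).ΘVp_le 𝒜 hC q)
      (fun n q => Config.dominated_ΘVp 𝒜 (hp n) q)

/-! ### One pass of the algorithm -/

namespace LearningRules

variable {S A O Q : Type*} [Fintype S] (R : LearningRules S A Q)

theorem prune_union_nonempty [Nonempty (Belief S)] {Θ : Finset (S → ℝ)} (hΘ : Θ.Nonempty)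
    (Θ' : Finset (S → ℝ)) [DecidableEq (S → ℝ)] : (R.prune (Θ ∪ Θ')).Nonempty := by
  obtain ⟨θ, hθ⟩ := hΘ
  obtain ⟨θ', h, -⟩ := R.prune_spec (Θ ∪ Θ') (Classical.arbitrary _) θ
    (Finset.mem_union_left _ hθ)
  exact ⟨θ', h⟩

theorem dominated_prune_union (Θ Θ' : Finset (S → ℝ)) [DecidableEq (S → ℝ)] :
    Dominated Θ (R.prune (Θ ∪ Θ')) :=
  fun b θ hθ => R.prune_spec _ b θ (Finset.mem_union_left _ hθ)

/-- The sum has `l.length` terms of norm at most `C`, and the division by `l.length` turns it into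
an average. -/
theorem norm_backup_le (ρ : S → ℝ) {g C : ℝ} (hg : 0 ≤ g) (hC : 0 ≤ C) {Θ : Finset (S → ℝ)}
    (hΘ : Θ.Nonempty) (hle : ∀ θ ∈ Θ, ‖θ‖ ≤ C) (l : List (Belief S)) :
    ‖R.backup ρ g Θ l‖ ≤ ‖ρ‖ + g * C := by
  have hsum : ‖(l.map (R.argmax Θ)).sum‖ ≤ l.length * C := by
    induction l with
    | nil => simp
    | cons b l ih =>
      rw [List.map_cons, List.sum_cons, List.length_cons]
      push_cast
      have h := hle _ (R.argmax_mem Θ hΘ b)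
      linarith [norm_add_le (R.argmax Θ b) (l.map (R.argmax Θ)).sum]
  refine (norm_add_le _ _).trans (add_le_add le_rfl ?_)
  rw [norm_smul, Real.norm_of_nonneg (by positivity)]
  refine (mul_le_mul_of_nonneg_left hsum (by positivity)).trans ?_
  rw [← mul_assoc]
  refine mul_le_mul_of_nonneg_right ?_ hC
  rcases eq_or_ne (l.length : ℝ) 0 with h | h
  -- For an empty list, `g / 0 = 0` and the backup is just `ρ`.
  · rw [h]; simpa using hg
  · rw [div_mul_cancel₀ _ h]

theorem prune_union_singleton_le {Θ : Finset (S → ℝ)} {θ₀ : S → ℝ} {C : ℝ} [DecidableEq (S → ℝ)]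
    (hΘ : ∀ θ ∈ Θ, ‖θ‖ ≤ C) (h₀ : ‖θ₀‖ ≤ C) : ∀ θ ∈ R.prune (Θ ∪ {θ₀}), ‖θ‖ ≤ C := by
  intro θ hθ
  rcases Finset.mem_union.1 (R.prune_subset _ hθ) with h | h
  · exact hΘ θ h
  · rwa [Finset.mem_singleton.1 h]

theorem _root_.Function.update_update_induction {α β γ : Type*} [DecidableEq α] [DecidableEq β]
    {f : α → β → γ} {a : α} {b : β} {v : γ} {P : α → β → γ → Prop}
    (hf : ∀ i j, P i j (f i j)) (hv : P a b v) (i : α) (j : β) :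
    P i j (Function.update f a (Function.update (f a) b v) i j) := by
  by_cases hi : i = a
  · subst hi
    by_cases hj : j = b
    · subst hj; simpa using hv
    · simpa [hj] using hf i j
  · simpa [hi] using hf i j

variable {R} [Fintype A] [Fintype O] {M : POMDP S A O} {φ : ILTL S} {𝒜 : LDBA Q (Set φ.atoms)}

theorem learn_boundedBy [Nonempty A] {c : Config S A Q} {C : ℝ} (h1 : 1 ≤ C)
    (hr : ‖M.r‖ + M.γ * C ≤ C) (hc : c.BoundedBy C) (a : A) (p' : Belief S × Q) :
    (R.learn M 𝒜 c a p').BoundedBy C := by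
  classical
  -- The pruning rule only speaks about beliefs, so a belief is needed to see that pruning does not
  -- empty a set.
  have : Nonempty (Belief S) := ⟨M.p₀⟩
  have h0 : 0 ≤ C := zero_le_one.trans h1
  refine ⟨?_, ?_, ?_, ?_⟩
  · exact Function.update_update_induction
      (P := fun _ _ (Θ : Finset (S → ℝ)) => Θ.Nonempty) hc.r_nonempty
      (R.prune_union_nonempty (hc.r_nonempty _ _) _)
  · exact Function.update_update_induction
      (P := fun _ _ (Θ : Finset (S → ℝ)) => Θ.Nonempty) hc.p_nonempty
      (R.prune_union_nonempty (hc.p_nonempty _ _) _)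
  · refine Function.update_update_induction
      (P := fun _ _ (Θ : Finset (S → ℝ)) => ∀ θ ∈ Θ, ‖θ‖ ≤ C) hc.r_le
      (R.prune_union_singleton_le (hc.r_le _ _) ?_)
    exact (R.norm_backup_le _ M.γ_pos.le h0 (hc.ΘVr_nonempty _) (hc.ΘVr_le _) _).trans hr
  · refine Function.update_update_induction
      (P := fun _ _ (Θ : Finset (S → ℝ)) => ∀ θ ∈ Θ, ‖θ‖ ≤ C) hc.p_le
      (R.prune_union_singleton_le (hc.p_le _ _) ?_)
    refine (R.norm_backup_le _ zero_le_one h0 (hc.ΘVp_nonempty 𝒜 _) (hc.ΘVp_le 𝒜 h1 _) _).trans ?_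
    simp

theorem dominated_learn_Θr (c : Config S A Q) (a : A) (p' : Belief S × Q) (q : Q) (a' : A) :
    Dominated (c.Θr q a') ((R.learn M 𝒜 c a p').Θr q a') := by
  classical
  exact Function.update_update_induction (P := fun q a Θ => Dominated (c.Θr q a) Θ)
    (fun _ _ => Dominated.refl _) (R.dominated_prune_union _ _) q a'

theorem dominated_learn_Θp (c : Config S A Q) (a : A) (p' : Belief S × Q) (q : Q) (a' : A) :
    Dominated (c.Θp q a') ((R.learn M 𝒜 c a p').Θp q a') := by
  classical
  exact Function.update_update_induction (P := fun q a Θ => Dominated (c.Θp q a) Θ)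
    (fun _ _ => Dominated.refl _) (R.dominated_prune_union _ _) q a'

/-- Bounds and monotonicity hold for every action and every successor, so the probabilities can be
forgotten. -/
theorem exists_of_mem_support_step {c c' : Config S A Q} (h : c' ∈ (R.step M 𝒜 c).support) :
    ∃ a p' p, c' = { R.learn M 𝒜 c a p' with cur := p } := by
  simp only [step, PMF.mem_support_bind_iff, PMF.mem_support_map_iff] at h
  obtain ⟨a, -, p', -, p, -, rfl⟩ := h
  exact ⟨a, p', p, rfl⟩

variable (R M 𝒜)

theorem exists_init_boundedBy [Finite Q] :
    ∃ C, 1 ≤ C ∧ ‖M.r‖ + M.γ * C ≤ C ∧ (R.init M 𝒜).BoundedBy C := by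
  have hfin : (⋃ q : Q, ⋃ a : A, (fun θ : S → ℝ => ‖θ‖) ''
      ((R.initΘr q a : Set (S → ℝ)) ∪ R.initΘp q a)).Finite :=
    Set.finite_iUnion fun q => Set.finite_iUnion fun a =>
      ((R.initΘr q a).finite_toSet.union (R.initΘp q a).finite_toSet).image _
  obtain ⟨D, hD⟩ := hfin.bddAbove
  have hγ : 0 < 1 - M.γ := sub_pos.2 M.γ_lt_one
  have hD' : ∀ q a, ∀ θ, θ ∈ R.initΘr q a ∨ θ ∈ R.initΘp q a → ‖θ‖ ≤ D := fun q a θ hθ =>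
    hD (Set.mem_iUnion₂.2 ⟨q, a, θ, hθ, rfl⟩)
  -- `‖r‖ + γ C ≤ C` amounts to `‖r‖ / (1 - γ) ≤ C`; `D` bounds the finitely many initial vectors.
  refine ⟨max (max 1 (‖M.r‖ / (1 - M.γ))) D, le_max_of_le_left (le_max_left _ _), ?_,
    R.initΘr_nonempty, R.initΘp_nonempty,
    fun q a θ hθ => le_max_of_le_right (hD' q a θ (Or.inl hθ)),
    fun q a θ hθ => le_max_of_le_right (hD' q a θ (Or.inr hθ))⟩
  have h : ‖M.r‖ / (1 - M.γ) ≤ max (max 1 (‖M.r‖ / (1 - M.γ))) D :=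
    le_max_of_le_left (le_max_right _ _)
  rw [div_le_iff₀ hγ] at h
  linarith

theorem learningConverges_of_isExecution [Finite Q] {x : ℕ → Config S A Q}
    (hx : R.IsExecution M 𝒜 x) : LearningConverges 𝒜 x := by
  -- A probability law on `A` has non-empty support.
  have : Nonempty A := (R.explore (R.init M 𝒜)).support_nonempty.to_type
  obtain ⟨C, h1, hr, h0⟩ := R.exists_init_boundedBy M 𝒜
  choose a p' p hstep using fun n => exists_of_mem_support_step (hx.2 n)
  refine .of_dominated 𝒜 h1 (fun n => ?_) (fun n => ?_) (fun n => ?_)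
  · induction n with
    | zero => rw [hx.1]; exact h0
    | succ n ih =>
      rw [hstep n]
      -- The bound does not involve `cur`, so its four parts transfer to the configuration with the
      -- new current state.
      obtain ⟨h₁, h₂, h₃, h₄⟩ := learn_boundedBy (R := R) (M := M) (𝒜 := 𝒜) h1 hr ih (a n) (p' n)
      exact ⟨h₁, h₂, h₃, h₄⟩
  · rw [hstep n]
    exact dominated_learn_Θr (R := R) (M := M) (𝒜 := 𝒜) (x n) (a n) (p' n)
  · rw [hstep n]
    exact dominated_learn_Θp (R := R) (M := M) (𝒜 := 𝒜) (x n) (a n) (p' n)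

/-! ### Runs are almost surely executions -/

section Run

variable {R M 𝒜} {W : Type*} [MeasurableSpace W] {P : Measure W}
  {X : ℕ → W → Config S A Q}

theorem IsRun.measurableSet_prefix (hX : R.IsRun M 𝒜 P X) (n : ℕ) (h : ℕ → Config S A Q) :
    MeasurableSet {ω | ∀ i ≤ n, X i ω = h i} := by
  simp only [Set.ofPred_forall]
  exact MeasurableSet.iInter fun i => MeasurableSet.iInter fun _ => hX.measurable i (h i)

variable [IsProbabilityMeasure P]

/-- Almost surely, a run that begins with the prefix `h 0, …, h n` goes on with a transition of
positive probability. -/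
theorem IsRun.ae_succ_mem_support (hX : R.IsRun M 𝒜 P X) (n : ℕ) (h : ℕ → Config S A Q) :
    ∀ᵐ ω ∂P, (∀ i ≤ n, X i ω = h i) → X (n + 1) ω ∈ (R.step M 𝒜 (h n)).support := by
  classical
  set E : Set W := {ω | ∀ i ≤ n, X i ω = h i} with hE
  set D := (R.step M 𝒜 (h n)).support with hD
  have : Countable D := (R.step M 𝒜 (h n)).support_countable.to_subtype
  set G : Config S A Q → Set W := fun c => {ω | X (n + 1) ω = c} with hG
  have hEG : ∀ c, P (E ∩ G c) = P E * R.step M 𝒜 (h n) c := by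
    intro c
    -- The Markov property is applied to the prefix prolonged by `c` at time `n + 1`.
    have := hX.markov n (Function.update h (n + 1) c)
    have h₁ : {ω | ∀ i ≤ n + 1, X i ω = Function.update h (n + 1) c i} = E ∩ G c := by
      ext ω
      constructor
      · intro hω
        refine ⟨fun i hi => ?_, by simpa [hG] using hω (n + 1) le_rfl⟩
        simpa [(Nat.lt_succ_of_le hi).ne] using hω i (hi.trans n.le_succ)
      · rintro ⟨hω, hc⟩ i hi
        rcases Nat.le_succ_iff.1 hi with hi | rfl
        · simpa [(Nat.lt_succ_of_le hi).ne] using hω i hi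
        · simpa [hG] using hc
    have h₂ : {ω | ∀ i ≤ n, X i ω = Function.update h (n + 1) c i} = E := by
      ext ω
      refine forall₂_congr fun i hi => ?_
      simp [(Nat.lt_succ_of_le hi).ne]
    rw [h₁, h₂] at this
    simpa using this
  -- Only events `X n = c` are known to be measurable; countability of the support makes this union
  -- measurable.
  have hmeas : MeasurableSet (⋃ c : D, E ∩ G c) := MeasurableSet.iUnion fun c =>
    (hX.measurableSet_prefix n h).inter (hX.measurable (n + 1) c)
  -- The events are disjoint and the transition law has total mass one on its support, so together
  -- they exhaust `E` up to a null set.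
  have hP : P (⋃ c : D, E ∩ G c) = P E := by
    rw [measure_iUnion]
    · simp_rw [hEG, ENNReal.tsum_mul_left]
      rw [tsum_subtype_eq_of_support_subset (f := R.step M 𝒜 (h n)) (s := D) subset_rfl,
        PMF.tsum_coe, mul_one]
    · intro c c' hne
      refine Set.disjoint_left.2 fun ω h₁ h₂ => hne (Subtype.ext ?_)
      exact h₁.2.symm.trans h₂.2
    · exact fun c => (hX.measurableSet_prefix n h).inter (hX.measurable (n + 1) c)
  have hsub : (⋃ c : D, E ∩ G c) ⊆ E := Set.iUnion_subset fun c => Set.inter_subset_left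
  have hdiff : P (E \ ⋃ c : D, E ∩ G c) = 0 := by
    rw [measure_sdiff hsub hmeas.nullMeasurableSet (measure_ne_top _ _), hP, tsub_self]
  filter_upwards [measure_eq_zero_iff_ae_notMem.1 hdiff] with ω hω hωE
  by_contra hcon
  refine hω ⟨hωE, fun hmem => ?_⟩
  obtain ⟨c, -, hc⟩ := Set.mem_iUnion.1 hmem
  exact hcon (by rw [show X (n + 1) ω = c from hc]; exact c.2)

/-- Each prefix has countably many continuations of positive probability, so countability passes
from `n` to `n + 1`. This permits a countable union of the null sets of `IsRun.ae_succ_mem_support`,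
one per prefix. -/
theorem IsRun.exists_countable_prefixes (hX : R.IsRun M 𝒜 P X) (n : ℕ) :
    ∃ H : Set (ℕ → Config S A Q), H.Countable ∧
      ∀ᵐ ω ∂P, ∃ h ∈ H, ∀ i ≤ n, X i ω = h i := by
  classical
  induction n with
  | zero =>
    refine ⟨{fun _ => R.init M 𝒜}, Set.countable_singleton _, ?_⟩
    filter_upwards [hX.start] with ω hω
    exact ⟨_, rfl, fun i hi => by rw [Nat.le_zero.1 hi, hω]⟩
  | succ n ih =>
    obtain ⟨H, hH, hae⟩ := ih
    refine ⟨⋃ h ∈ H, (fun c => Function.update h (n + 1) c) '' (R.step M 𝒜 (h n)).support,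
      hH.biUnion fun h _ => (PMF.support_countable _).image _, ?_⟩
    filter_upwards [hae, (ae_ball_iff hH).2 fun h _ => hX.ae_succ_mem_support n h]
      with ω ⟨h, hh, hω⟩ hsucc
    refine ⟨_, Set.mem_biUnion hh ⟨X (n + 1) ω, hsucc h hh hω, rfl⟩, fun i hi => ?_⟩
    rcases Nat.le_succ_iff.1 hi with hi | rfl
    · simpa [(Nat.lt_succ_of_le hi).ne] using hω i hi
    · simp

theorem IsRun.ae_isExecution (hX : R.IsRun M 𝒜 P X) :
    ∀ᵐ ω ∂P, R.IsExecution M 𝒜 (fun n => X n ω) := by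
  have hsucc : ∀ᵐ ω ∂P, ∀ n, X (n + 1) ω ∈ (R.step M 𝒜 (X n ω)).support := by
    refine ae_all_iff.2 fun n => ?_
    obtain ⟨H, hH, hae⟩ := hX.exists_countable_prefixes n
    filter_upwards [hae, (ae_ball_iff hH).2 fun h _ => hX.ae_succ_mem_support n h]
      with ω ⟨h, hh, hω⟩ hs
    rw [hω n le_rfl]
    exact hs h hh hω
  filter_upwards [hX.start, hsucc] with ω h₀ h₁
  exact ⟨h₀, h₁⟩

end Run

end LearningRules

theorem mainTheorem4 {S A O Q : Type*} [Fintype S] [Fintype A] [Fintype O] [Fintype Q]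
    (M : POMDP S A O) (φ : ILTL S) (𝒜 : LDBA Q (Set φ.atoms)) (h𝒜 : 𝒜.Realizes)
    (R : LearningRules S A Q) :
    (∀ x : ℕ → Config S A Q, R.IsExecution M 𝒜 x → LearningConverges 𝒜 x) ∧
    (∀ {W : Type*} [MeasurableSpace W] (P : Measure W) [IsProbabilityMeasure P]
      (X : ℕ → W → Config S A Q), R.IsRun M 𝒜 P X →
        ∀ᵐ ω ∂P, LearningConverges 𝒜 (fun n => X n ω)) :=
  ⟨fun _ hx => R.learningConverges_of_isExecution M 𝒜 hx, fun _ _ _ hX =>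
    hX.ae_isExecution.mono fun _ hω => R.learningConverges_of_isExecution M 𝒜 hω⟩
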